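/- Let $p\ge 3$, $1\le k\le\binom p2$, $n\ge 0$ be integers and let $\omega\ge 1$, $0<\lambda\le\omega$ be real. For a graph $G=(V,E)$ on $V=\{1,\dots,p\}$ and a vector $\theta=(\theta_{st})$ indexed by the unordered pairs of distinct vertices, with $\theta_{st}=0$ for $(s,t)\notin E$, let $\mathbb P_{\theta}$ be the Ising model $$\mathbb P_{\theta}(x)=\frac{\exp\big(\sum_{(s,t)\in E}\theta_{st}x_sx_t\big)}{\sum_{y\in\{-1,+1\}^p}\exp\big(\sum_{(s,t)\in E}\theta_{st}y_sy_t\big)},\qquad x\in\{-1,+1\}^p .$$ Let $\mathcal G_{p,k}$ be the set of graphs on $V$ with at most $k$ edges, and let $\mathcal G_{p,k}(\lambda,\omega)$ be the class of all such models $\theta=\theta(G)$ with $G\in\mathcal G_{p,k}$, $$\min_{(s,t)\in E}|\theta_{st}|\ge\lambda\quad\text{and}\quad \max_{s\in V}\sum_{t:(s,t)\in E}|\theta_{st}|\le\omega$$ (the minimum over an empty edge set is $+\infty$). Suppose that $$n\le\max\Big\{\frac{\log p}{2\lambda\tanh\lambda},\ \frac{e^{\omega/2}\,\log(k/8)}{64\,\omega\,e^{5\lambda/2}\sinh\lambda}\Big\}.$$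 Then every graph decoder $\phi$, which maps $n$ i.i.d. samples $X_1^n=(X^{(1)},\dots,X^{(n)})$ from $\mathbb P_{\theta(G)}$ to a graph in $\mathcal G_{p,k}$, satisfies $$\max_{\theta(G)\in\mathcal G_{p,k}(\lambda,\omega)}\mathbb P_{\theta(G)}\big[\phi(X_1^n)\ne G\big]\ \ge\ \tfrac12 .$$ The same holds for decoders that know the edge weights: if $\phi$ may depend on an assignment $\Theta$ that gives each graph $G$ for which this is possible a vector $\Theta(G)$ with which it belongs to $\mathcal G_{p,k}(\lambda,\omega)$, then for some such assignment $\Theta$ and some $G$ in its domain, $\mathbb P_{\Theta(G)}\big[\phi(\Theta,X_1^n)\ne G\big]\ge\tfrac12$. -/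

import Mathlib

open scoped BigOperators

noncomputable section

namespace IsingSelection

/-- Spin configurations: elements of `{-1, +1}^p`. -/
abbrev Config (p : ℕ) : Type := Fin p → ℤˣ

/-- Parameter vectors, indexed by unordered pairs of vertices. A diagonal entry never plays a role:
it is zero as soon as the vector respects a (loopless) graph. -/
abbrev Weights (p : ℕ) : Type := Sym2 (Fin p) → ℝ

/-- The product `x_s x_t` of the two spins at the ends of an unordered pair. -/
def pairSpin {p : ℕ} (x : Config p) : Sym2 (Fin p) → ℝ :=
  Sym2.lift ⟨fun s t => ((x s : ℤ) : ℝ) * ((x t : ℤ) : ℝ), fun _ _ => mul_comm _ _⟩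

open Classical in
/-- The unnormalised Ising weight `exp (∑_{(s,t) ∈ E} θ_{st} x_s x_t)`. -/
def boltzmann {p : ℕ} (G : SimpleGraph (Fin p)) (θ : Weights p) (x : Config p) : ℝ :=
  Real.exp (∑ e ∈ G.edgeFinset, θ e * pairSpin x e)

/-- The normalisation factor of the Ising model. -/
def partitionFn {p : ℕ} (G : SimpleGraph (Fin p)) (θ : Weights p) : ℝ :=
  ∑ x : Config p, boltzmann G θ x

/-- The probability mass function of the Ising model on the graph `G` with edge weights `θ`. -/
def isingProb {p : ℕ} (G : SimpleGraph (Fin p)) (θ : Weights p) (x : Config p) : ℝ :=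
  boltzmann G θ x / partitionFn G θ

/-- The minimum edge weight `min_{(s,t) ∈ E} |θ_{st}|`, with value `+∞` for the empty edge set. -/
def minEdgeWeight {p : ℕ} (G : SimpleGraph (Fin p)) (θ : Weights p) : EReal :=
  ⨅ e ∈ G.edgeSet, ((|θ e| : ℝ) : EReal)

open Classical in
/-- The maximum neighbourhood weight `max_s ∑_{t ∈ N(s)} |θ_{st}|`. -/
def maxNeighborWeight {p : ℕ} (G : SimpleGraph (Fin p)) (θ : Weights p) : ℝ :=
  ⨆ s : Fin p, ∑ t ∈ G.neighborFinset s, |θ s(s, t)|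

/-- The graphs on `p` vertices with at most `k` edges. -/
def GraphClass (p k : ℕ) : Set (SimpleGraph (Fin p)) :=
  {G | G.edgeSet.ncard ≤ k}

/-- The pair `(G, θ)` specifies a member of the class of Ising models on graphs with at most `k`
edges, minimum edge weight at least `lam` and maximum neighbourhood weight at most `ω`. -/
structure IsModel (p k : ℕ) (lam ω : ℝ) (G : SimpleGraph (Fin p)) (θ : Weights p) : Prop where
  mem_graphClass : G ∈ GraphClass p k
  respects : ∀ e, θ e ≠ 0 → e ∈ G.edgeSet
  le_minEdgeWeight : (lam : EReal) ≤ minEdgeWeight G θ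
  maxNeighborWeight_le : maxNeighborWeight G θ ≤ ω

/-- A graph decoder based on `n` samples, without side information. -/
abbrev Decoder (n p k : ℕ) : Type := (Fin n → Config p) → GraphClass p k

open Classical in
/-- The probability that the decoder `φ` does not return the graph `G`, when the `n` samples are
drawn independently from the Ising model on `G` with edge weights `θ`. -/
def errorProb {n p k : ℕ} (φ : Decoder n p k) (G : SimpleGraph (Fin p)) (θ : Weights p) : ℝ :=
  ∑ x : Fin n → Config p,
    if (φ x : SimpleGraph (Fin p)) ≠ G then ∏ i, isingProb G θ (x i) else 0

/-- `Θ` assigns an admissible parameter vector `Θ G` to every graph `G` that carries one. In the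
variant with known edge weights, this assignment is available to the decoder. -/
def IsWeightAssignment (p k : ℕ) (lam ω : ℝ) (Θ : SimpleGraph (Fin p) → Weights p) : Prop :=
  ∀ G, (∃ θ, IsModel p k lam ω G θ) → IsModel p k lam ω G (Θ G)

/-- A graph decoder with known edge weights: for every candidate graph `G` it knows the vector
`Θ G`, so it is a decoder that may depend on the assignment `Θ` in an arbitrary way. -/
abbrev InformedDecoder (n p k : ℕ) : Type :=
  (SimpleGraph (Fin p) → Weights p) → Decoder n p k

end IsingSelection

end

namespace IsingSelection

/-! Fix a base model and compare it with the models obtained by adding one edge of weight `lam`.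
Give the base prior weight `A` and each of the `r` perturbations weight 1, and let `L e` be the
likelihood ratios. A decoder is right with mass at most the mean of `max A (max_e L e)`, so some
error is at least 1/2 once this mean is at most `(r + A) / 2` (`exists_half_le_error`). Dominating
the positive parts of `L e - A` by squares of `L e - 1` reduces this to second moments at most `r /
2` (`IsBase.informedError_of_sq_le`).

Since a spin product is ±1, the one-sample second moment depends only on the base correlation `μ` of
the new pair and is at most `1 + tanh² lam * (1 - μ²)` when `μ ≥ 0`.

For the first bound the base is the edgeless graph: `μ = 0` and all pairs are candidates. The
general criterion just misses at `p = 3`, where pairwise uncorrelatedness of the likelihood ratios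
supplies a sharper dominating function.

For the second bound the base is a path with strong bonds, and the candidates are its chords of
length two. Their ends almost always agree, so `1 - μ²` is exponentially small in `ω` and a chord is
nearly invisible. This is needed only when the second bound exceeds the first, which already forces
`ω` to be large compared with `lam`. -/

/-! ### The weighted Bayes bound -/

lemma sum_ite_le {ι : Type*} [Fintype ι] {P : ι → Prop} [DecidablePred P] {c : ℝ} (hc : 0 ≤ c)
    (hP : ∀ i j, P i → P j → i = j) : ∑ i, (if P i then c else 0) ≤ c := by
  rw [← Finset.sum_filter, Finset.sum_const, nsmul_eq_mul]
  have : (Finset.univ.filter P).card ≤ 1 := Finset.card_le_one.2 fun i hi j hj =>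
    hP i j (Finset.mem_filter.1 hi).2 (Finset.mem_filter.1 hj).2
  exact mul_le_of_le_one_left hc (by exact_mod_cast this)

/-- Weighted Bayes bound: if `F` dominates the positive parts of `L e - A`, where `L e` is the
likelihood ratio of the hypothesis `g e` against the base `g0`, and the mean of `F` under the base
is small, then every decision rule errs with probability at least one half somewhere. -/
theorem exists_half_le_error {X ι γ : Type*} [Fintype X] [DecidableEq γ]
    (w : X → ℝ) (hw : ∀ x, 0 ≤ w x) (E : Finset ι) (L : ι → X → ℝ)
    (hL : ∀ e ∈ E, ∑ x, w x * L e x = 1) (g0 : γ) (g : ι → γ)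
    (hg : Set.InjOn g E) (φ : X → γ) (A : ℝ) (hA : 0 < A)
    (hg0 : ∀ e ∈ E, g e ≠ g0) (F : X → ℝ) (hF : ∀ x, 0 ≤ F x)
    (hLF : ∀ e ∈ E, ∀ x, L e x - A ≤ F x)
    (hmean : ∑ x, w x * F x ≤ ((E.card : ℝ) - A) / 2) :
    1 / 2 ≤ (∑ x, if φ x ≠ g0 then w x else 0) ∨
      ∃ e ∈ E, 1 / 2 ≤ ∑ x, if φ x ≠ g e then w x * L e x else 0 := by
  classical
  by_contra! hcon
  obtain ⟨h0, h1⟩ := hcon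
  -- Of the posterior mass `A + ∑ L e` at `x`, a decision saves at most one term, `A` or some `L e ≤
  -- A + F`; the rest is error.
  have hpt : ∀ x, w x * (∑ e ∈ E, L e x) - w x * F x ≤
      A * (if φ x ≠ g0 then w x else 0) +
        ∑ e ∈ E, if φ x ≠ g e then w x * L e x else 0 := by
    intro x
    by_cases hx0 : φ x = g0
    · have : ∑ e ∈ E, (if φ x ≠ g e then w x * L e x else 0) = w x * ∑ e ∈ E, L e x := by
        rw [Finset.mul_sum]
        refine Finset.sum_congr rfl fun e he => if_pos ?_
        rw [hx0]
        exact (hg0 e he).symm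
      rw [this, if_neg (not_not.2 hx0)]
      nlinarith [mul_nonneg (hw x) (hF x)]
    · rw [if_pos hx0]
      by_cases hx1 : ∃ e ∈ E, φ x = g e
      · obtain ⟨e, he, hxe⟩ := hx1
        have : ∑ f ∈ E, (if φ x ≠ g f then w x * L f x else 0) =
            w x * (∑ f ∈ E, L f x) - w x * L e x := by
          rw [← Finset.add_sum_erase E (fun f => L f x) he, ← Finset.add_sum_erase E _ he,
            if_neg (not_not.2 hxe), mul_add, Finset.mul_sum, zero_add, add_sub_cancel_left]
          refine Finset.sum_congr rfl fun f hf => if_pos ?_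
          rw [hxe]
          exact fun h => (Finset.ne_of_mem_erase hf) (hg (Finset.mem_of_mem_erase hf) he h.symm)
        rw [this]
        nlinarith [mul_le_mul_of_nonneg_left (hLF e he x) (hw x)]
      · push Not at hx1
        have : ∑ e ∈ E, (if φ x ≠ g e then w x * L e x else 0) = w x * ∑ e ∈ E, L e x := by
          rw [Finset.mul_sum]
          exact Finset.sum_congr rfl fun e he => if_pos (hx1 e he)
        rw [this]
        nlinarith [mul_nonneg (hw x) (hF x), mul_nonneg hA.le (hw x)]
  have hsum := Finset.sum_le_sum fun x (_ : x ∈ Finset.univ) => hpt x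
  rw [Finset.sum_sub_distrib, Finset.sum_add_distrib, ← Finset.mul_sum, Finset.sum_comm] at hsum
  have hcard : ∑ x, w x * ∑ e ∈ E, L e x = E.card := by
    simp_rw [Finset.mul_sum]
    rw [Finset.sum_comm, Finset.sum_congr rfl hL]
    simp
  have herr : ∑ e ∈ E, ∑ x, (if φ x ≠ g e then w x * L e x else 0) ≤ E.card * (1 / 2) := by
    rw [← nsmul_eq_mul]
    exact Finset.sum_le_card_nsmul _ _ _ fun e he => (h1 e he).le
  have := mul_lt_mul_of_pos_left h0 hA
  rw [hcard] at hsum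
  linarith

/-! ### Likelihood ratio of one added edge, for one sample -/

lemma pairSpin_mk {p : ℕ} (x : Config p) (s t : Fin p) :
    pairSpin x s(s, t) = ((x s : ℤ) : ℝ) * ((x t : ℤ) : ℝ) := rfl

lemma spin_mul_self (u : ℤˣ) : ((u : ℤ) : ℝ) * ((u : ℤ) : ℝ) = 1 := by
  rcases Int.units_eq_one_or u with h | h <;> simp [h]

lemma pairSpin_mul_self {p : ℕ} (x : Config p) (e : Sym2 (Fin p)) :
    pairSpin x e * pairSpin x e = 1 := by
  induction e with
  | _ s t =>
    rw [pairSpin_mk]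
    linear_combination ((x s : ℤ) : ℝ) * ((x s : ℤ) : ℝ) * spin_mul_self (x t)
      + spin_mul_self (x s)

lemma pairSpin_eq_or {p : ℕ} (x : Config p) (e : Sym2 (Fin p)) :
    pairSpin x e = 1 ∨ pairSpin x e = -1 :=
  mul_self_eq_one_iff.1 (pairSpin_mul_self x e)

/-- Summing over all pairs removes the graph from the energy, so that models on different graphs can
be compared. -/
lemma boltzmann_eq {p : ℕ} {G : SimpleGraph (Fin p)} {θ : Weights p}
    (h : ∀ e, θ e ≠ 0 → e ∈ G.edgeSet) (x : Config p) :
    boltzmann G θ x = Real.exp (∑ e, θ e * pairSpin x e) := by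
  classical
  unfold boltzmann
  congr 1
  refine Finset.sum_subset (Finset.subset_univ _) fun e _ he => ?_
  rw [SimpleGraph.mem_edgeFinset] at he
  rw [not_imp_comm.1 (h e) he, zero_mul]

lemma partitionFn_pos {p : ℕ} (G : SimpleGraph (Fin p)) (θ : Weights p) :
    0 < partitionFn G θ :=
  Finset.sum_pos (fun _ _ => Real.exp_pos _) Finset.univ_nonempty

lemma isingProb_pos {p : ℕ} (G : SimpleGraph (Fin p)) (θ : Weights p) (x : Config p) :
    0 < isingProb G θ x :=
  div_pos (Real.exp_pos _) (partitionFn_pos G θ)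

lemma sum_isingProb {p : ℕ} (G : SimpleGraph (Fin p)) (θ : Weights p) :
    ∑ x, isingProb G θ x = 1 := by
  unfold isingProb
  rw [← Finset.sum_div]
  exact div_self (partitionFn_pos G θ).ne'

/-- The mean of the product of the two spins at the ends of a pair. -/
noncomputable def correlation {p : ℕ} (G : SimpleGraph (Fin p)) (θ : Weights p)
    (e : Sym2 (Fin p)) : ℝ :=
  ∑ x, isingProb G θ x * pairSpin x e

/-- The likelihood ratio, for one sample, of the model with an additional edge `e` of weight `lam`
against the base model. -/
noncomputable def edgeRatio {p : ℕ} (lam : ℝ) (G : SimpleGraph (Fin p)) (θ : Weights p)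
    (e : Sym2 (Fin p)) (x : Config p) : ℝ :=
  Real.exp (lam * pairSpin x e) / ∑ y, isingProb G θ y * Real.exp (lam * pairSpin y e)

lemma exp_mul_pairSpin {p : ℕ} (lam : ℝ) (x : Config p) (e : Sym2 (Fin p)) :
    Real.exp (lam * pairSpin x e) = Real.cosh lam + Real.sinh lam * pairSpin x e := by
  rcases pairSpin_eq_or x e with h | h
  · rw [h, mul_one, mul_one, Real.cosh_add_sinh]
  · rw [h, mul_neg_one, mul_neg_one, ← sub_eq_add_neg, Real.cosh_sub_sinh]

lemma sum_isingProb_mul_exp {p : ℕ} (lam : ℝ) (G : SimpleGraph (Fin p)) (θ : Weights p)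
    (e : Sym2 (Fin p)) :
    ∑ y, isingProb G θ y * Real.exp (lam * pairSpin y e) =
      Real.cosh lam + Real.sinh lam * correlation G θ e := by
  unfold correlation
  simp_rw [exp_mul_pairSpin, mul_add, Finset.sum_add_distrib, ← Finset.sum_mul, sum_isingProb,
    Finset.mul_sum, one_mul]
  congr 1
  exact Finset.sum_congr rfl fun _ _ => by ring

lemma sum_isingProb_mul_exp_pos {p : ℕ} (lam : ℝ) (G : SimpleGraph (Fin p)) (θ : Weights p)
    (e : Sym2 (Fin p)) :
    0 < ∑ y, isingProb G θ y * Real.exp (lam * pairSpin y e) :=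
  Finset.sum_pos (fun y _ => mul_pos (isingProb_pos G θ y) (Real.exp_pos _))
    Finset.univ_nonempty

lemma sum_isingProb_mul_edgeRatio {p : ℕ} (lam : ℝ) (G : SimpleGraph (Fin p)) (θ : Weights p)
    (e : Sym2 (Fin p)) : ∑ x, isingProb G θ x * edgeRatio lam G θ e x = 1 := by
  unfold edgeRatio
  simp_rw [mul_div_assoc', ← Finset.sum_div]
  exact div_self (sum_isingProb_mul_exp_pos lam G θ e).ne'

/-- With `c = cosh lam`, `s = sinh lam`, the ratio is `(c + s * pairSpin) / (c + s * μ)`. Its second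
moment is exactly `1 + s² (1 - μ²) / (c + s μ)²`, and `μ ≥ 0` allows the denominator to be replaced
by `c²`. -/
lemma sum_isingProb_mul_edgeRatio_sq_le {p : ℕ} {lam : ℝ} (hlam : 0 < lam)
    (G : SimpleGraph (Fin p)) (θ : Weights p) (e : Sym2 (Fin p)) (hμ : 0 ≤ correlation G θ e) :
    ∑ x, isingProb G θ x * edgeRatio lam G θ e x ^ 2 ≤
      1 + Real.tanh lam ^ 2 * (1 - correlation G θ e ^ 2) := by
  have hc := Real.cosh_pos lam
  have hs := Real.sinh_pos_iff.2 hlam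
  have hsq : ∀ x : Config p, isingProb G θ x * edgeRatio lam G θ e x ^ 2 =
      (isingProb G θ x * (Real.cosh lam ^ 2 + Real.sinh lam ^ 2) +
        2 * Real.cosh lam * Real.sinh lam * (isingProb G θ x * pairSpin x e)) /
      (Real.cosh lam + Real.sinh lam * correlation G θ e) ^ 2 := by
    intro x
    unfold edgeRatio
    rw [sum_isingProb_mul_exp, exp_mul_pairSpin, div_pow, mul_div_assoc']
    congr 1
    linear_combination isingProb G θ x * Real.sinh lam ^ 2 * pairSpin_mul_self x e
  simp_rw [hsq]
  rw [← Finset.sum_div, Finset.sum_add_distrib, ← Finset.sum_mul, sum_isingProb,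
    ← Finset.mul_sum]
  change (_ + 2 * Real.cosh lam * Real.sinh lam * correlation G θ e) / _ ≤ _
  set μ := correlation G θ e
  have hμ1 : μ ≤ 1 := by
    rw [← sum_isingProb G θ]
    refine Finset.sum_le_sum fun x _ => ?_
    have := isingProb_pos G θ x
    rcases pairSpin_eq_or x e with h | h <;> rw [h] <;> linarith
  rw [Real.tanh_eq_sinh_div_cosh]
  set c := Real.cosh lam
  set s := Real.sinh lam
  have hD : c ≤ c + s * μ := le_add_of_nonneg_right (mul_nonneg hs.le hμ)
  have h1 : (1 * (c ^ 2 + s ^ 2) + 2 * c * s * μ) / (c + s * μ) ^ 2 =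
      1 + s ^ 2 * (1 - μ ^ 2) / (c + s * μ) ^ 2 := by
    have : c + s * μ ≠ 0 := (hc.trans_le hD).ne'
    field_simp
    ring
  rw [h1, div_pow, div_mul_eq_mul_div]
  gcongr
  exact mul_nonneg (sq_nonneg s) (by nlinarith)

/-! ### Base models and their one-edge perturbations -/

/-- The base weights, together with the weight `lam` on every edge of `G` outside the base graph. -/
noncomputable def extendWeights {p : ℕ} (lam : ℝ) (G₀ : SimpleGraph (Fin p)) (θ₀ : Weights p)
    (G : SimpleGraph (Fin p)) : Weights p :=
  open Classical in
  fun e => θ₀ e + if e ∈ G.edgeSet \ G₀.edgeSet then lam else 0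

/-- The graph `G` with one more edge. -/
def addEdge {p : ℕ} (G : SimpleGraph (Fin p)) (e : Sym2 (Fin p)) : SimpleGraph (Fin p) :=
  G ⊔ SimpleGraph.fromEdgeSet {e}

lemma edgeSet_addEdge {p : ℕ} (G : SimpleGraph (Fin p)) {e : Sym2 (Fin p)} (he : ¬ e.IsDiag) :
    (addEdge G e).edgeSet = insert e G.edgeSet := by
  ext f
  simp only [addEdge, SimpleGraph.edgeSet_sup, SimpleGraph.edgeSet_fromEdgeSet, Set.mem_union,
    Set.mem_sdiff, Set.mem_singleton_iff, Set.mem_insert_iff]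
  constructor
  · rintro (h | h)
    exacts [Or.inr h, Or.inl h.1]
  · rintro (rfl | h)
    exacts [Or.inr ⟨rfl, he⟩, Or.inl h]

lemma extendWeights_self {p : ℕ} (lam : ℝ) (G₀ : SimpleGraph (Fin p)) (θ₀ : Weights p) :
    extendWeights lam G₀ θ₀ G₀ = θ₀ := by
  funext e
  simp [extendWeights]

open Classical in
lemma extendWeights_addEdge {p : ℕ} (lam : ℝ) {G₀ : SimpleGraph (Fin p)} (θ₀ : Weights p)
    {e : Sym2 (Fin p)} (he : ¬ e.IsDiag) (heG : e ∉ G₀.edgeSet) (f : Sym2 (Fin p)) :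
    extendWeights lam G₀ θ₀ (addEdge G₀ e) f = θ₀ f + if f = e then lam else 0 := by
  unfold extendWeights
  congr 1
  refine if_congr ?_ rfl rfl
  rw [edgeSet_addEdge G₀ he]
  constructor
  · rintro ⟨h | h, h'⟩
    exacts [h, absurd h h']
  · rintro rfl
    exact ⟨Or.inl rfl, heG⟩

/-- A base model to which any further edge of weight `lam` may be added without leaving the
class. -/
structure IsBase (p k : ℕ) (lam ω : ℝ) (G₀ : SimpleGraph (Fin p)) (θ₀ : Weights p) : Prop where
  ncard_lt : G₀.edgeSet.ncard < k
  respects : ∀ e, θ₀ e ≠ 0 → e ∈ G₀.edgeSet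
  le_abs : ∀ e ∈ G₀.edgeSet, lam ≤ |θ₀ e|
  sum_le : ∀ s, ∑ t, |θ₀ s(s, t)| ≤ ω - lam

namespace IsBase

variable {p k : ℕ} {lam ω : ℝ} {G₀ : SimpleGraph (Fin p)} {θ₀ : Weights p}

lemma isModel (h : IsBase p k lam ω G₀ θ₀) (hp : 0 < p) (hlam : 0 ≤ lam) :
    IsModel p k lam ω G₀ θ₀ where
  mem_graphClass := h.ncard_lt.le
  respects := h.respects
  le_minEdgeWeight := le_iInf₂ fun e he => EReal.coe_le_coe_iff.2 (h.le_abs e he)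
  maxNeighborWeight_le := by
    have : Nonempty (Fin p) := ⟨⟨0, hp⟩⟩
    refine ciSup_le fun s => ?_
    refine (Finset.sum_le_univ_sum_of_nonneg fun t => abs_nonneg _).trans ?_
    linarith [h.sum_le s]

lemma respects_addEdge (h : IsBase p k lam ω G₀ θ₀) {e : Sym2 (Fin p)} (he : ¬ e.IsDiag)
    (heG : e ∉ G₀.edgeSet) (f : Sym2 (Fin p))
    (hf : extendWeights lam G₀ θ₀ (addEdge G₀ e) f ≠ 0) : f ∈ (addEdge G₀ e).edgeSet := by
  rw [extendWeights_addEdge lam θ₀ he heG] at hf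
  rw [edgeSet_addEdge G₀ he]
  by_cases hfe : f = e
  · exact Or.inl hfe
  · rw [if_neg hfe, add_zero] at hf
    exact Or.inr (h.respects f hf)

lemma isModel_addEdge (h : IsBase p k lam ω G₀ θ₀) (hp : 0 < p) (hlam : 0 < lam)
    {e : Sym2 (Fin p)} (he : ¬ e.IsDiag) (heG : e ∉ G₀.edgeSet) :
    IsModel p k lam ω (addEdge G₀ e) (extendWeights lam G₀ θ₀ (addEdge G₀ e)) where
  mem_graphClass := by
    change (addEdge G₀ e).edgeSet.ncard ≤ k
    rw [edgeSet_addEdge G₀ he]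
    exact (Set.ncard_insert_le _ _).trans h.ncard_lt
  respects := h.respects_addEdge he heG
  le_minEdgeWeight := by
    refine le_iInf₂ fun f hf => EReal.coe_le_coe_iff.2 ?_
    rw [extendWeights_addEdge lam θ₀ he heG]
    rw [edgeSet_addEdge G₀ he] at hf
    rcases hf with rfl | hf
    · rw [if_pos rfl, not_imp_comm.1 (h.respects f) heG, zero_add]
      exact le_abs_self _
    · rw [if_neg fun hfe : f = e => heG (hfe ▸ hf), add_zero]
      exact h.le_abs f hf
  maxNeighborWeight_le := by
    classical
    have : Nonempty (Fin p) := ⟨⟨0, hp⟩⟩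
    refine ciSup_le fun s => ?_
    refine (Finset.sum_le_univ_sum_of_nonneg fun t => abs_nonneg _).trans ?_
    -- The new edge meets `s` at most once; the slack `lam` reserved in `sum_le` pays for it.
    have hnew : ∑ t, (if s(s, t) = e then lam else 0) ≤ lam :=
      sum_ite_le hlam.le fun t u ht hu => Sym2.congr_right.1 (ht.trans hu.symm)
    calc ∑ t, |extendWeights lam G₀ θ₀ (addEdge G₀ e) s(s, t)|
        ≤ ∑ t, (|θ₀ s(s, t)| + if s(s, t) = e then lam else 0) := by
          refine Finset.sum_le_sum fun t _ => ?_
          rw [extendWeights_addEdge lam θ₀ he heG]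
          refine (abs_add_le _ _).trans (add_le_add_right (le_of_eq ?_) _)
          exact abs_of_nonneg (by split_ifs <;> linarith)
      _ ≤ ω := by
          rw [Finset.sum_add_distrib]
          linarith [h.sum_le s]

lemma isingProb_addEdge (h : IsBase p k lam ω G₀ θ₀) {e : Sym2 (Fin p)} (he : ¬ e.IsDiag)
    (heG : e ∉ G₀.edgeSet) (x : Config p) :
    isingProb (addEdge G₀ e) (extendWeights lam G₀ θ₀ (addEdge G₀ e)) x =
      isingProb G₀ θ₀ x * edgeRatio lam G₀ θ₀ e x := by
  classical
  have hb : ∀ y : Config p, boltzmann (addEdge G₀ e) (extendWeights lam G₀ θ₀ (addEdge G₀ e)) y =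
      boltzmann G₀ θ₀ y * Real.exp (lam * pairSpin y e) := by
    intro y
    rw [boltzmann_eq (h.respects_addEdge he heG), boltzmann_eq h.respects, ← Real.exp_add]
    congr 1
    simp_rw [extendWeights_addEdge lam θ₀ he heG, add_mul, Finset.sum_add_distrib, ite_mul,
      zero_mul]
    simp
  have hZ := partitionFn_pos G₀ θ₀
  have hS : ∑ y, isingProb G₀ θ₀ y * Real.exp (lam * pairSpin y e) =
      partitionFn (addEdge G₀ e) (extendWeights lam G₀ θ₀ (addEdge G₀ e)) /
        partitionFn G₀ θ₀ := by
    conv_rhs => rw [partitionFn]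
    rw [Finset.sum_div]
    refine Finset.sum_congr rfl fun y _ => ?_
    rw [hb, isingProb]
    ring
  have hZ' := partitionFn_pos (addEdge G₀ e) (extendWeights lam G₀ θ₀ (addEdge G₀ e))
  rw [edgeRatio, hS, isingProb, isingProb, hb]
  field_simp

end IsBase

/-! ### Samples of size `n` and the second-moment criterion -/

/-- The probability of a sample of size `n`. -/
noncomputable def sampleProb {p : ℕ} (n : ℕ) (G : SimpleGraph (Fin p)) (θ : Weights p)
    (x : Fin n → Config p) : ℝ := ∏ i, isingProb G θ (x i)

/-- The likelihood ratio of a sample. -/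
noncomputable def sampleRatio {p : ℕ} (n : ℕ) (lam : ℝ) (G : SimpleGraph (Fin p)) (θ : Weights p)
    (e : Sym2 (Fin p)) (x : Fin n → Config p) : ℝ := ∏ i, edgeRatio lam G θ e (x i)

lemma sampleProb_nonneg {p : ℕ} (n : ℕ) (G : SimpleGraph (Fin p)) (θ : Weights p)
    (x : Fin n → Config p) : 0 ≤ sampleProb n G θ x :=
  Finset.prod_nonneg fun i _ => (isingProb_pos G θ (x i)).le

lemma sum_sampleProb {p : ℕ} (n : ℕ) (G : SimpleGraph (Fin p)) (θ : Weights p) :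
    ∑ x, sampleProb n G θ x = 1 := by
  unfold sampleProb
  rw [← Fintype.sum_pow, sum_isingProb, one_pow]

lemma sum_sampleProb_mul_sampleRatio {p : ℕ} (n : ℕ) (lam : ℝ) (G : SimpleGraph (Fin p))
    (θ : Weights p) (e : Sym2 (Fin p)) :
    ∑ x, sampleProb n G θ x * sampleRatio n lam G θ e x = 1 := by
  unfold sampleProb sampleRatio
  simp_rw [← Finset.prod_mul_distrib]
  rw [← Fintype.sum_pow (fun y => isingProb G θ y * edgeRatio lam G θ e y),
    sum_isingProb_mul_edgeRatio, one_pow]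

lemma sum_sampleProb_mul_mul {p : ℕ} (n : ℕ) (lam : ℝ) (G : SimpleGraph (Fin p))
    (θ : Weights p) (e f : Sym2 (Fin p)) :
    ∑ x, sampleProb n G θ x * (sampleRatio n lam G θ e x * sampleRatio n lam G θ f x) =
      (∑ y, isingProb G θ y * (edgeRatio lam G θ e y * edgeRatio lam G θ f y)) ^ n := by
  unfold sampleProb sampleRatio
  simp_rw [← Finset.prod_mul_distrib]
  rw [← Fintype.sum_pow (fun y => isingProb G θ y *
    (edgeRatio lam G θ e y * edgeRatio lam G θ f y))]

lemma sum_sampleProb_mul_sub_one_mul {p : ℕ} (n : ℕ) (lam : ℝ) (G : SimpleGraph (Fin p))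
    (θ : Weights p) (e f : Sym2 (Fin p)) :
    ∑ x, sampleProb n G θ x * ((sampleRatio n lam G θ e x - 1) * (sampleRatio n lam G θ f x - 1)) =
      (∑ y, isingProb G θ y * (edgeRatio lam G θ e y * edgeRatio lam G θ f y)) ^ n - 1 := by
  have h : ∀ x, sampleProb n G θ x *
      ((sampleRatio n lam G θ e x - 1) * (sampleRatio n lam G θ f x - 1)) =
      sampleProb n G θ x * (sampleRatio n lam G θ e x * sampleRatio n lam G θ f x) -
      sampleProb n G θ x * sampleRatio n lam G θ e x -
      sampleProb n G θ x * sampleRatio n lam G θ f x + sampleProb n G θ x := fun x => by ring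
  simp_rw [h]
  rw [Finset.sum_add_distrib, Finset.sum_sub_distrib, Finset.sum_sub_distrib,
    sum_sampleProb_mul_mul, sum_sampleProb_mul_sampleRatio, sum_sampleProb_mul_sampleRatio,
    sum_sampleProb]
  ring

/-- Some assignment of weights makes a given informed decoder err on some graph of the class. -/
def InformedError {n p k : ℕ} (lam ω : ℝ) (φ : InformedDecoder n p k) : Prop :=
  ∃ Θ : SimpleGraph (Fin p) → Weights p, IsWeightAssignment p k lam ω Θ ∧
    ∃ G : SimpleGraph (Fin p), IsModel p k lam ω G (Θ G) ∧ 1 / 2 ≤ errorProb (φ Θ) G (Θ G)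

/-- The informed decoder sees one assignment, which must serve all hypotheses at once: keep the
prescribed weights wherever they are admissible, and choose any admissible vector elsewhere. -/
lemma exists_isWeightAssignment {p : ℕ} (k : ℕ) (lam ω : ℝ)
    (T : SimpleGraph (Fin p) → Weights p) :
    ∃ Θ, IsWeightAssignment p k lam ω Θ ∧ ∀ G, IsModel p k lam ω G (T G) → Θ G = T G := by
  classical
  refine ⟨fun G => if IsModel p k lam ω G (T G) then T G else
    if h : ∃ θ, IsModel p k lam ω G θ then h.choose else 0, fun G hG => ?_, fun G hG => if_pos hG⟩
  dsimp only
  split_ifs with h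
  exacts [h, hG.choose_spec]

theorem IsBase.informedError {n p k : ℕ} {lam ω : ℝ} {G₀ : SimpleGraph (Fin p)} {θ₀ : Weights p}
    (h : IsBase p k lam ω G₀ θ₀) (hp : 0 < p) (hlam : 0 < lam) (φ : InformedDecoder n p k)
    (E : Finset (Sym2 (Fin p))) (hE : ∀ e ∈ E, ¬ e.IsDiag ∧ e ∉ G₀.edgeSet)
    (A : ℝ) (hA : 0 < A) (F : (Fin n → Config p) → ℝ) (hF : ∀ x, 0 ≤ F x)
    (hLF : ∀ e ∈ E, ∀ x, sampleRatio n lam G₀ θ₀ e x - A ≤ F x)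
    (hmean : ∑ x, sampleProb n G₀ θ₀ x * F x ≤ ((E.card : ℝ) - A) / 2) :
    InformedError lam ω φ := by
  classical
  obtain ⟨Θ, hΘ, hΘT⟩ := exists_isWeightAssignment k lam ω (extendWeights lam G₀ θ₀)
  have hne : ∀ e ∈ E, addEdge G₀ e ≠ G₀ := by
    intro e he heq
    apply (hE e he).2
    rw [← heq, edgeSet_addEdge G₀ (hE e he).1]
    exact Set.mem_insert _ _
  have hinj : Set.InjOn (addEdge G₀) E := by
    intro e he f hf hef
    have hmem : e ∈ (addEdge G₀ f).edgeSet := by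
      rw [← hef, edgeSet_addEdge G₀ (hE e he).1]
      exact Set.mem_insert _ _
    rw [edgeSet_addEdge G₀ (hE f hf).1] at hmem
    exact hmem.resolve_right (hE e he).2
  have h0 : IsModel p k lam ω G₀ (extendWeights lam G₀ θ₀ G₀) := by
    rw [extendWeights_self]
    exact h.isModel hp hlam.le
  refine ⟨Θ, hΘ, ?_⟩
  rcases exists_half_le_error (sampleProb n G₀ θ₀) (sampleProb_nonneg n G₀ θ₀) E
    (sampleRatio n lam G₀ θ₀) (fun e _ => sum_sampleProb_mul_sampleRatio n lam G₀ θ₀ e) G₀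
    (addEdge G₀) hinj (fun x => (φ Θ x : SimpleGraph (Fin p))) A hA hne F hF hLF hmean
    with herr | ⟨e, he, herr⟩
  · refine ⟨G₀, by rwa [hΘT _ h0], ?_⟩
    rw [hΘT _ h0, extendWeights_self]
    refine herr.trans (le_of_eq ?_)
    unfold errorProb
    exact Finset.sum_congr rfl fun x _ => if_congr Iff.rfl rfl rfl
  · have h1 := h.isModel_addEdge hp hlam (hE e he).1 (hE e he).2
    refine ⟨addEdge G₀ e, by rwa [hΘT _ h1], ?_⟩
    rw [hΘT _ h1]
    refine herr.trans (le_of_eq ?_)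
    unfold errorProb
    refine Finset.sum_congr rfl fun x _ => if_congr Iff.rfl ?_ rfl
    simp_rw [h.isingProb_addEdge (hE e he).1 (hE e he).2, Finset.prod_mul_distrib]
    rfl

/-- The second-moment criterion. -/
theorem IsBase.informedError_of_sq_le {n p k : ℕ} {lam ω : ℝ} {G₀ : SimpleGraph (Fin p)}
    {θ₀ : Weights p} (h : IsBase p k lam ω G₀ θ₀) (hp : 0 < p) (hlam : 0 < lam)
    (φ : InformedDecoder n p k) (E : Finset (Sym2 (Fin p)))
    (hE : ∀ e ∈ E, ¬ e.IsDiag ∧ e ∉ G₀.edgeSet) (hcard : 2 ≤ E.card)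
    (hsq : ∀ e ∈ E, (∑ y, isingProb G₀ θ₀ y * edgeRatio lam G₀ θ₀ e y ^ 2) ^ n ≤
      (E.card : ℝ) / 2) :
    InformedError lam ω φ := by
  have hr : (2 : ℝ) ≤ E.card := by exact_mod_cast hcard
  set r : ℝ := (E.card : ℝ)
  have hB : 0 < 2 * (r - 1) := by linarith
  -- With `u = L - 1`, the domination `u - (r - 1) / 2 ≤ u² / (2 (r - 1))` is `(u - (r - 1))² ≥ 0`.
  refine h.informedError hp hlam φ E hE (1 + (r - 1) / 2) (by linarith)
    (fun x => ∑ e ∈ E, (sampleRatio n lam G₀ θ₀ e x - 1) * (sampleRatio n lam G₀ θ₀ e x - 1) /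
      (2 * (r - 1)))
    (fun x => Finset.sum_nonneg fun e _ => div_nonneg (mul_self_nonneg _) hB.le) ?_ ?_
  · intro e he x
    refine le_trans ?_ (Finset.single_le_sum
      (f := fun e => (sampleRatio n lam G₀ θ₀ e x - 1) * (sampleRatio n lam G₀ θ₀ e x - 1) /
        (2 * (r - 1))) (fun f _ => div_nonneg (mul_self_nonneg _) hB.le) he)
    rw [le_div_iff₀ hB]
    nlinarith [sq_nonneg (sampleRatio n lam G₀ θ₀ e x - 1 - (r - 1))]
  · simp_rw [Finset.mul_sum, mul_div_assoc']
    rw [Finset.sum_comm]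
    simp_rw [← Finset.sum_div, sum_sampleProb_mul_sub_one_mul, ← sq]
    rw [div_le_iff₀ hB]
    -- What remains is `r (r - 2) ≤ (r - 1)²`.
    calc _ ≤ ∑ e ∈ E, (r / 2 - 1) := Finset.sum_le_sum fun e he => by linarith [hsq e he]
      _ = r * (r / 2 - 1) := by rw [Finset.sum_const, nsmul_eq_mul]
      _ ≤ _ := by nlinarith

/-! ### The edgeless base model and the first sample size bound -/

/-- Reversal of the spins on a set of vertices. -/
def flipSpins {p : ℕ} (S : Finset (Fin p)) (x : Config p) : Config p :=
  fun i => if i ∈ S then -x i else x i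

lemma flipSpins_involutive {p : ℕ} (S : Finset (Fin p)) :
    Function.Involutive (flipSpins S) := by
  intro x
  funext i
  by_cases h : i ∈ S <;> simp [flipSpins, h]

lemma pairSpin_flipSpins_of_iff {p : ℕ} {S : Finset (Fin p)} (x : Config p) {s t : Fin p}
    (h : s ∈ S ↔ t ∈ S) : pairSpin (flipSpins S x) s(s, t) = pairSpin x s(s, t) := by
  by_cases hs : s ∈ S
  · simp [pairSpin_mk, flipSpins, hs, h.1 hs]
  · simp [pairSpin_mk, flipSpins, hs, mt h.2 hs]

lemma pairSpin_flipSpins_of_mem {p : ℕ} {S : Finset (Fin p)} (x : Config p) {s t : Fin p}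
    (hs : s ∈ S) (ht : t ∉ S) : pairSpin (flipSpins S x) s(s, t) = -pairSpin x s(s, t) := by
  simp [pairSpin_mk, flipSpins, hs, ht]

lemma sum_flipSpins {p : ℕ} (S : Finset (Fin p)) (f : Config p → ℝ) :
    ∑ x, f (flipSpins S x) = ∑ x, f x :=
  Equiv.sum_comp (flipSpins_involutive S).toPerm f

lemma isingProb_bot {p : ℕ} (x y : Config p) :
    isingProb (⊥ : SimpleGraph (Fin p)) 0 x = isingProb ⊥ 0 y := by
  unfold isingProb
  rw [boltzmann_eq (by simp), boltzmann_eq (by simp)]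
  simp

/-- The uniform law is invariant under spin reversals, so odd functions average to zero. -/
lemma sum_isingProb_bot_eq_zero {p : ℕ} (S : Finset (Fin p)) (f : Config p → ℝ)
    (hf : ∀ x, f (flipSpins S x) = -f x) :
    ∑ x, isingProb (⊥ : SimpleGraph (Fin p)) 0 x * f x = 0 := by
  have h := sum_flipSpins S fun x => isingProb (⊥ : SimpleGraph (Fin p)) 0 x * f x
  have h' : ∀ x, isingProb (⊥ : SimpleGraph (Fin p)) 0 (flipSpins S x) * f (flipSpins S x) =
      -(isingProb (⊥ : SimpleGraph (Fin p)) 0 x * f x) := fun x => by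
    rw [hf, isingProb_bot (flipSpins S x) x, mul_neg]
  simp_rw [h', Finset.sum_neg_distrib] at h
  linarith

lemma pairSpin_flipSpins_singleton {p : ℕ} (x : Config p) {s t : Fin p} (h : s ≠ t) :
    pairSpin (flipSpins {s} x) s(s, t) = -pairSpin x s(s, t) :=
  pairSpin_flipSpins_of_mem x (Finset.mem_singleton_self s) fun h' =>
    h (Finset.mem_singleton.1 h').symm

lemma correlation_bot {p : ℕ} {e : Sym2 (Fin p)} (he : ¬ e.IsDiag) :
    correlation (⊥ : SimpleGraph (Fin p)) 0 e = 0 := by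
  induction e with
  | _ s t => exact sum_isingProb_bot_eq_zero {s} _ fun x => pairSpin_flipSpins_singleton x he

lemma edgeRatio_bot {p : ℕ} (lam : ℝ) {e : Sym2 (Fin p)} (he : ¬ e.IsDiag) (x : Config p) :
    edgeRatio lam (⊥ : SimpleGraph (Fin p)) 0 e x = 1 + Real.tanh lam * pairSpin x e := by
  have := (Real.cosh_pos lam).ne'
  rw [edgeRatio, sum_isingProb_mul_exp, correlation_bot he, exp_mul_pairSpin,
    Real.tanh_eq_sinh_div_cosh, mul_zero, add_zero]
  field_simp

/-- Two edges `{s, t}`, `{u, v}` with `s ∉ {u, v}` are uncorrelated under the uniform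
distribution. -/
lemma sum_isingProb_bot_mul_edgeRatio_mul {p : ℕ} (lam : ℝ) {s t u v : Fin p} (hst : s ≠ t)
    (huv : u ≠ v) (hsu : s ≠ u) (hsv : s ≠ v) :
    ∑ x, isingProb (⊥ : SimpleGraph (Fin p)) 0 x *
      (edgeRatio lam ⊥ 0 s(s, t) x * edgeRatio lam ⊥ 0 s(u, v) x) = 1 := by
  have h : ∀ x, isingProb (⊥ : SimpleGraph (Fin p)) 0 x *
      (edgeRatio lam ⊥ 0 s(s, t) x * edgeRatio lam ⊥ 0 s(u, v) x) =
      isingProb (⊥ : SimpleGraph (Fin p)) 0 x * edgeRatio lam ⊥ 0 s(u, v) x +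
      isingProb (⊥ : SimpleGraph (Fin p)) 0 x * (Real.tanh lam * pairSpin x s(s, t) *
        (1 + Real.tanh lam * pairSpin x s(u, v))) := fun x => by
    rw [edgeRatio_bot lam (e := s(s, t)) hst, edgeRatio_bot lam (e := s(u, v)) huv]
    ring
  simp_rw [h]
  rw [Finset.sum_add_distrib, sum_isingProb_mul_edgeRatio,
    sum_isingProb_bot_eq_zero {s} _ fun x => ?_, add_zero]
  rw [pairSpin_flipSpins_singleton x hst, pairSpin_flipSpins_of_iff x (s := u) (t := v)]
  · ring
  · simp [hsu.symm, hsv.symm]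

lemma isBase_bot {p k : ℕ} {lam ω : ℝ} (hk : 1 ≤ k) (h : lam ≤ ω) :
    IsBase p k lam ω (⊥ : SimpleGraph (Fin p)) 0 where
  ncard_lt := by simpa using Nat.pos_of_ne_zero (by omega)
  respects := by simp
  le_abs := by simp
  sum_le s := by simpa using h

lemma tanh_pos {x : ℝ} (hx : 0 < x) : 0 < Real.tanh x := by
  rw [Real.tanh_eq_sinh_div_cosh]
  exact div_pos (Real.sinh_pos_iff.2 hx) (Real.cosh_pos x)

lemma tanh_le_sinh {x : ℝ} (hx : 0 < x) : Real.tanh x ≤ Real.sinh x := by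
  rw [Real.tanh_eq_sinh_div_cosh]
  exact div_le_self (Real.sinh_pos_iff.2 hx).le (Real.one_le_cosh x)

lemma tanh_le_one {x : ℝ} : Real.tanh x ≤ 1 := by
  rw [Real.tanh_eq_sinh_div_cosh, div_le_one (Real.cosh_pos x)]
  exact (Real.sinh_lt_cosh x).le

lemma tanh_le_self {x : ℝ} (hx : 0 < x) : Real.tanh x ≤ x := by
  have hmono : MonotoneOn (fun y : ℝ => y * Real.cosh y - Real.sinh y) (Set.Ici 0) := by
    refine monotoneOn_of_deriv_nonneg (convex_Ici 0) (by fun_prop) (by fun_prop) fun y hy => ?_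
    rw [interior_Ici] at hy
    have hd : HasDerivAt (fun y : ℝ => y * Real.cosh y - Real.sinh y)
        (1 * Real.cosh y + y * Real.sinh y - Real.cosh y) y :=
      ((hasDerivAt_id y).mul (Real.hasDerivAt_cosh y)).sub (Real.hasDerivAt_sinh y)
    rw [hd.deriv]
    have := mul_pos (Set.mem_Ioi.1 hy) (Real.sinh_pos_iff.2 hy)
    linarith
  have := hmono (Set.mem_Ici.2 le_rfl) (Set.mem_Ici.2 hx.le) hx.le
  simp only [zero_mul, Real.sinh_zero, sub_zero] at this
  rw [Real.tanh_eq_sinh_div_cosh, div_le_iff₀ (Real.cosh_pos x)]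
  linarith

/-- Here `μ = 0`, so the moment is at most `exp (n tanh² lam)`; `tanh lam ≤ lam` and the bound on
`n` make the exponent at most `log p / 2`. -/
lemma sq_moment_bot_le {p n : ℕ} {lam : ℝ} (hp : 3 ≤ p) (hlam : 0 < lam)
    (hn : (n : ℝ) ≤ Real.log p / (2 * lam * Real.tanh lam)) {e : Sym2 (Fin p)}
    (he : ¬ e.IsDiag) :
    (∑ y, isingProb (⊥ : SimpleGraph (Fin p)) 0 y * edgeRatio lam ⊥ 0 e y ^ 2) ^ n ≤ √p := by
  have ht := tanh_pos hlam
  have hp0 : (0 : ℝ) < p := by positivity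
  have h1 := sum_isingProb_mul_edgeRatio_sq_le hlam (⊥ : SimpleGraph (Fin p)) 0 e
    (correlation_bot he).ge
  rw [correlation_bot he] at h1
  have h2 : ∑ y, isingProb (⊥ : SimpleGraph (Fin p)) 0 y * edgeRatio lam ⊥ 0 e y ^ 2 ≤
      Real.exp (Real.tanh lam ^ 2) := by
    linarith [Real.add_one_le_exp (Real.tanh lam ^ 2)]
  refine (pow_le_pow_left₀ (Finset.sum_nonneg fun y _ =>
    mul_nonneg (isingProb_pos _ _ y).le (sq_nonneg _)) h2 n).trans ?_
  rw [← Real.exp_nat_mul, Real.sqrt_eq_rpow, Real.rpow_def_of_pos hp0, Real.exp_le_exp]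
  rw [le_div_iff₀ (by positivity)] at hn
  have : (n : ℝ) * Real.tanh lam * Real.tanh lam ≤ n * Real.tanh lam * lam :=
    mul_le_mul_of_nonneg_left (tanh_le_self hlam) (by positivity)
  nlinarith

/-- For three vertices, the prior `(5, 3, 3, 3) / 14` on the empty graph and the single edges. -/
theorem informedError_of_three_vertices {n k : ℕ} {lam ω : ℝ} (hk : 1 ≤ k) (hlam : 0 < lam)
    (hlamω : lam ≤ ω) (hn : (n : ℝ) ≤ Real.log (3 : ℕ) / (2 * lam * Real.tanh lam))
    (φ : InformedDecoder n 3 k) : InformedError lam ω φ := by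
  set b : Sym2 (Fin 3) → (Fin n → Config 3) → ℝ :=
    fun e x => sampleRatio n lam (⊥ : SimpleGraph (Fin 3)) 0 e x - 1 with hb
  -- A symmetric quadratic touching 0 at `u = v = w = -1/2` and `u - 2/3` at `(11/6, -1/6, -1/6)`.
  -- Its cross terms will have mean zero.
  have hquad : ∀ u v w : ℝ, 0 ≤ 1 / 8 + (u + v + w) / 6 - (u + v + w) ^ 2 / 36 +
      (u ^ 2 + v ^ 2 + w ^ 2) / 4 ∧ u - 2 / 3 ≤ 1 / 8 + (u + v + w) / 6 - (u + v + w) ^ 2 / 36 +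
      (u ^ 2 + v ^ 2 + w ^ 2) / 4 := by
    intro u v w
    constructor
    · nlinarith [sq_nonneg (u - v), sq_nonneg (u - w), sq_nonneg (v - w),
        sq_nonneg (u + v + w + 3 / 2)]
    · nlinarith [sq_nonneg (v - w), sq_nonneg (u + v + w - 3 / 2),
        sq_nonneg (3 * u - (u + v + w) - 4)]
  have hw : ∑ x, sampleProb n (⊥ : SimpleGraph (Fin 3)) 0 x = 1 := sum_sampleProb _ _ _
  have hb1 : ∀ e, ∑ x, sampleProb n (⊥ : SimpleGraph (Fin 3)) 0 x * b e x = 0 := by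
    intro e
    simp_rw [hb, mul_sub, mul_one, Finset.sum_sub_distrib]
    rw [sum_sampleProb_mul_sampleRatio, hw, sub_self]
  have hb2 : ∀ e : Sym2 (Fin 3), ¬ e.IsDiag →
      ∑ x, sampleProb n (⊥ : SimpleGraph (Fin 3)) 0 x * (b e x * b e x) ≤ 13 / 16 := by
    intro e he
    have h := sq_moment_bot_le le_rfl hlam hn he
    -- Variances up to 13/16 are just affordable: `1/8 + 3 * (2/9) * (13/16) = 2/3 = (3 - 5/3) / 2`.
    have hs : √((3 : ℕ) : ℝ) ≤ 29 / 16 := by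
      rw [Real.sqrt_le_left (by norm_num)]
      norm_num
    rw [sum_sampleProb_mul_sub_one_mul]
    simp_rw [← sq]
    exact sub_le_iff_le_add.2 ((h.trans hs).trans (by norm_num))
  have hcov : ∀ s t u v : Fin 3, s ≠ t → u ≠ v → s ≠ u → s ≠ v →
      ∑ x, sampleProb n (⊥ : SimpleGraph (Fin 3)) 0 x * (b s(s, t) x * b s(u, v) x) = 0 := by
    intro s t u v h1 h2 h3 h4
    rw [sum_sampleProb_mul_sub_one_mul, sum_isingProb_bot_mul_edgeRatio_mul lam h1 h2 h3 h4,
      one_pow, sub_self]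
  refine (isBase_bot hk hlamω).informedError (by norm_num) hlam φ {s(0, 1), s(0, 2), s(1, 2)}
    (by decide +revert) (5 / 3) (by norm_num)
    (fun x => 1 / 8 + (b s(0, 1) x + b s(0, 2) x + b s(1, 2) x) / 6 -
      (b s(0, 1) x + b s(0, 2) x + b s(1, 2) x) ^ 2 / 36 +
      (b s(0, 1) x ^ 2 + b s(0, 2) x ^ 2 + b s(1, 2) x ^ 2) / 4)
    (fun x => (hquad _ _ _).1) ?_ ?_
  · intro e he x
    simp only [Finset.mem_insert, Finset.mem_singleton] at he
    have hbe : sampleRatio n lam (⊥ : SimpleGraph (Fin 3)) 0 e x - 5 / 3 = b e x - 2 / 3 := by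
      rw [hb]
      ring
    rw [hbe]
    rcases he with rfl | rfl | rfl
    · exact (hquad _ _ _).2
    · linarith [(hquad (b s(0, 2) x) (b s(0, 1) x) (b s(1, 2) x)).2]
    · linarith [(hquad (b s(1, 2) x) (b s(0, 1) x) (b s(0, 2) x)).2]
  · have hcard : ({s(0, 1), s(0, 2), s(1, 2)} : Finset (Sym2 (Fin 3))).card = 3 := by decide
    rw [hcard]
    have hexp : ∀ x, sampleProb n (⊥ : SimpleGraph (Fin 3)) 0 x *
        (1 / 8 + (b s(0, 1) x + b s(0, 2) x + b s(1, 2) x) / 6 -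
          (b s(0, 1) x + b s(0, 2) x + b s(1, 2) x) ^ 2 / 36 +
          (b s(0, 1) x ^ 2 + b s(0, 2) x ^ 2 + b s(1, 2) x ^ 2) / 4) =
        1 / 8 * sampleProb n (⊥ : SimpleGraph (Fin 3)) 0 x +
        1 / 6 * (sampleProb n (⊥ : SimpleGraph (Fin 3)) 0 x * b s(0, 1) x) +
        1 / 6 * (sampleProb n (⊥ : SimpleGraph (Fin 3)) 0 x * b s(0, 2) x) +
        1 / 6 * (sampleProb n (⊥ : SimpleGraph (Fin 3)) 0 x * b s(1, 2) x) +
        2 / 9 * (sampleProb n (⊥ : SimpleGraph (Fin 3)) 0 x * (b s(0, 1) x * b s(0, 1) x)) +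
        2 / 9 * (sampleProb n (⊥ : SimpleGraph (Fin 3)) 0 x * (b s(0, 2) x * b s(0, 2) x)) +
        2 / 9 * (sampleProb n (⊥ : SimpleGraph (Fin 3)) 0 x * (b s(1, 2) x * b s(1, 2) x)) -
        1 / 18 * (sampleProb n (⊥ : SimpleGraph (Fin 3)) 0 x * (b s(1, 0) x * b s(0, 2) x)) -
        1 / 18 * (sampleProb n (⊥ : SimpleGraph (Fin 3)) 0 x * (b s(0, 1) x * b s(1, 2) x)) -
        1 / 18 * (sampleProb n (⊥ : SimpleGraph (Fin 3)) 0 x * (b s(0, 2) x * b s(1, 2) x)) := by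
      intro x
      -- `hcov` needs the first-named vertex to lie outside the other pair, hence `s(1, 0)` against
      -- `s(0, 2)`.
      rw [Sym2.eq_swap (a := (1 : Fin 3)) (b := 0)]
      ring
    simp_rw [hexp]
    simp only [Finset.sum_add_distrib, Finset.sum_sub_distrib, ← Finset.mul_sum]
    rw [hw, hb1, hb1, hb1, hcov 1 0 0 2 (by decide) (by decide) (by decide) (by decide),
      hcov 0 1 1 2 (by decide) (by decide) (by decide) (by decide),
      hcov 0 2 1 2 (by decide) (by decide) (by decide) (by decide)]
    have h1 := hb2 s(0, 1) (by decide)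
    have h2 := hb2 s(0, 2) (by decide)
    have h3 := hb2 s(1, 2) (by decide)
    norm_num
    linarith

theorem informedError_of_le_log_div {n p k : ℕ} {lam ω : ℝ} (hp : 3 ≤ p) (hk : 1 ≤ k)
    (hlam : 0 < lam) (hlamω : lam ≤ ω)
    (hn : (n : ℝ) ≤ Real.log p / (2 * lam * Real.tanh lam)) (φ : InformedDecoder n p k) :
    InformedError lam ω φ := by
  classical
  -- The criterion asks for `√p ≤ p (p - 1) / 4`, which fails at 3 and holds from 4 on.
  obtain rfl | hp4 : p = 3 ∨ 4 ≤ p := by omega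
  · exact informedError_of_three_vertices hk hlam hlamω hn φ
  set E : Finset (Sym2 (Fin p)) := Finset.univ.filter fun e => ¬ e.IsDiag with hE
  have hcard : E.card = p.choose 2 := by
    rw [hE, ← Fintype.card_subtype, Sym2.card_subtype_not_diag, Fintype.card_fin]
  have hp4' : (4 : ℝ) ≤ p := by exact_mod_cast hp4
  have hcard' : (E.card : ℝ) = p * (p - 1) / 2 := by rw [hcard, Nat.cast_choose_two]
  refine (isBase_bot hk hlamω).informedError_of_sq_le (by omega) hlam φ E
    (fun e he => ⟨(Finset.mem_filter.1 he).2, by simp⟩) ?_ fun e he => ?_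
  · have : (2 : ℝ) ≤ E.card := by rw [hcard']; nlinarith
    exact_mod_cast this
  · refine (sq_moment_bot_le hp hlam hn (Finset.mem_filter.1 he).2).trans ?_
    rw [hcard', Real.sqrt_le_left (by nlinarith)]
    have h3 : (3 : ℝ) * 3 * p ≤ (p - 1) * (p - 1) * p := by
      have : (3 : ℝ) ≤ p - 1 := by linarith
      gcongr
    nlinarith

/-! ### The path base model and the second sample size bound -/

/-- The path through the first `q` vertices. -/
def initialPath (p q : ℕ) : SimpleGraph (Fin p) where
  Adj i j := ((i : ℕ) + 1 = j ∧ (j : ℕ) < q) ∨ ((j : ℕ) + 1 = i ∧ (i : ℕ) < q)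
  symm := ⟨fun _ _ h => h.symm⟩
  loopless := ⟨fun i h => by omega⟩

lemma initialPath_adj {p q : ℕ} {i j : Fin p} : s(i, j) ∈ (initialPath p q).edgeSet ↔
    ((i : ℕ) + 1 = j ∧ (j : ℕ) < q) ∨ ((j : ℕ) + 1 = i ∧ (i : ℕ) < q) := Iff.rfl

/-- Constant weights `a` on the edges of the path through the first `q` vertices. -/
noncomputable def pathWeights (p q : ℕ) (a : ℝ) : Weights p :=
  open Classical in
  fun e => if e ∈ (initialPath p q).edgeSet then a else 0

lemma mem_of_pathWeights_ne_zero {p q : ℕ} {a : ℝ} (e : Sym2 (Fin p))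
    (h : pathWeights p q a e ≠ 0) : e ∈ (initialPath p q).edgeSet := by
  by_contra he
  exact h (if_neg he)

lemma ncard_initialPath_le {p q : ℕ} (hqp : q ≤ p) :
    (initialPath p q).edgeSet.ncard ≤ q - 1 := by
  have hsub : (initialPath p q).edgeSet ⊆ Set.range fun m : Fin (q - 1) =>
      (s(⟨m, by omega⟩, ⟨m + 1, by omega⟩) : Sym2 (Fin p)) := by
    intro e
    induction e with
    | _ i j =>
      rw [initialPath_adj]
      rintro (⟨h, hq⟩ | ⟨h, hq⟩)
      · refine ⟨⟨i, by omega⟩, Sym2.eq_iff.2 (Or.inl ⟨rfl, Fin.ext h⟩)⟩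
      · refine ⟨⟨j, by omega⟩, Sym2.eq_iff.2 (Or.inr ⟨rfl, Fin.ext h⟩)⟩
  refine (Set.ncard_le_ncard hsub (Set.toFinite _)).trans ?_
  rw [← Set.image_univ]
  refine (Set.ncard_image_le (Set.toFinite _)).trans ?_
  rw [Set.ncard_univ, Nat.card_fin]

lemma isBase_initialPath {p q k : ℕ} {a lam ω : ℝ} (hqp : q ≤ p) (hqk : q ≤ k) (hq : 0 < q)
    (hlam : 0 < lam) (ha : lam ≤ a) (haω : 2 * a ≤ ω - lam) :
    IsBase p k lam ω (initialPath p q) (pathWeights p q a) where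
  ncard_lt := (ncard_initialPath_le hqp).trans_lt (by omega)
  respects := mem_of_pathWeights_ne_zero
  le_abs e he := by
    rw [pathWeights, if_pos he]
    exact ha.trans (le_abs_self a)
  sum_le s := by
    have ha0 : 0 ≤ a := hlam.le.trans ha
    calc ∑ t, |pathWeights p q a s(s, t)|
        ≤ ∑ t : Fin p, ((if (s : ℕ) + 1 = t then a else 0) +
            if (t : ℕ) + 1 = s then a else 0) := by
          refine Finset.sum_le_sum fun t _ => ?_
          unfold pathWeights
          split_ifs with h h1 h2 h2
          · omega
          · rw [abs_of_nonneg ha0, add_zero]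
          · rw [abs_of_nonneg ha0, zero_add]
          · rw [initialPath_adj] at h
            omega
          all_goals rw [abs_zero]; positivity
      _ ≤ 2 * a := by
          rw [Finset.sum_add_distrib, two_mul]
          exact add_le_add (sum_ite_le ha0 fun t u ht hu => Fin.ext (by omega))
            (sum_ite_le ha0 fun t u ht hu => Fin.ext (by omega))
      _ ≤ ω - lam := haω

/-- Reversing all spins on one side of an edge shows that its end spins rarely disagree. -/
lemma one_sub_correlation_bond_le {p q : ℕ} {a : ℝ} {i j : Fin p}
    (hij : (i : ℕ) + 1 = j) (hj : (j : ℕ) < q) :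
    1 - correlation (initialPath p q) (pathWeights p q a) s(i, j) ≤ 2 * Real.exp (-(2 * a)) := by
  set G := initialPath p q
  set θ := pathWeights p q a
  set S : Finset (Fin p) := Finset.univ.filter fun m => (m : ℕ) ≤ i
  have hmem : ∀ m, m ∈ S ↔ (m : ℕ) ≤ i := fun m => by simp [S]
  have hbond : ∀ x, pairSpin (flipSpins S x) s(i, j) = -pairSpin x s(i, j) := fun x =>
    pairSpin_flipSpins_of_mem x ((hmem i).2 le_rfl) (by rw [hmem]; omega)
  -- The bond `s(i, j)` is the only path edge between `S` and its complement.
  have henergy : ∀ x, ∑ e, θ e * pairSpin (flipSpins S x) e =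
      ∑ e, θ e * pairSpin x e + -(2 * a) * pairSpin x s(i, j) := by
    intro x
    rw [← Finset.add_sum_erase _ _ (Finset.mem_univ s(i, j)),
      ← Finset.add_sum_erase _ (fun e => θ e * pairSpin x e) (Finset.mem_univ s(i, j)), hbond]
    have hθe : θ s(i, j) = a := if_pos (initialPath_adj.2 (Or.inl ⟨hij, hj⟩))
    have hrest : ∑ e ∈ Finset.univ.erase s(i, j), θ e * pairSpin (flipSpins S x) e =
        ∑ e ∈ Finset.univ.erase s(i, j), θ e * pairSpin x e := by
      refine Finset.sum_congr rfl fun e he => ?_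
      by_cases h0 : θ e = 0
      · rw [h0, zero_mul, zero_mul]
      · have hG := mem_of_pathWeights_ne_zero e h0
        have hne := Finset.ne_of_mem_erase he
        congr 1
        induction e with
        | _ u v =>
          refine pairSpin_flipSpins_of_iff x ?_
          rw [hmem, hmem]
          rw [Ne, Sym2.eq_iff, Fin.ext_iff, Fin.ext_iff, Fin.ext_iff, Fin.ext_iff] at hne
          rw [initialPath_adj] at hG
          omega
    rw [hrest, hθe]
    ring
  have hprob : ∀ x, isingProb G θ (flipSpins S x) =
      isingProb G θ x * Real.exp (-(2 * a) * pairSpin x s(i, j)) := by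
    intro x
    unfold isingProb
    rw [boltzmann_eq mem_of_pathWeights_ne_zero, boltzmann_eq mem_of_pathWeights_ne_zero,
      henergy, Real.exp_add]
    ring
  have hone : 1 - correlation G θ s(i, j) = ∑ x, isingProb G θ x * (1 - pairSpin x s(i, j)) := by
    simp_rw [mul_sub, mul_one, Finset.sum_sub_distrib, sum_isingProb]
    rfl
  rw [hone, ← sum_flipSpins S]
  -- After reversal the summand vanishes unless the spins of `x` agree on the bond, and then it
  -- carries the factor `2 exp (-2a)`.
  calc ∑ x, isingProb G θ (flipSpins S x) * (1 - pairSpin (flipSpins S x) s(i, j))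
      ≤ ∑ x, isingProb G θ x * (2 * Real.exp (-(2 * a))) := by
        refine Finset.sum_le_sum fun x _ => ?_
        rw [hprob, hbond, mul_assoc]
        refine mul_le_mul_of_nonneg_left ?_ (isingProb_pos G θ x).le
        rcases pairSpin_eq_or x s(i, j) with h | h
        · rw [h, mul_one]
          exact le_of_eq (by ring)
        · rw [h]
          simp only [neg_neg, sub_self, mul_zero]
          positivity
    _ = 2 * Real.exp (-(2 * a)) := by rw [← Finset.sum_mul, sum_isingProb, one_mul]

/-- The chord's spin product is the product of those of the two bonds, and `uv ≥ u + v - 1` for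
signs `u`, `v`. -/
lemma one_sub_correlation_chord_le {p q : ℕ} {a : ℝ} {i j l : Fin p}
    (hij : (i : ℕ) + 1 = j) (hjl : (j : ℕ) + 1 = l) (hl : (l : ℕ) < q) :
    1 - correlation (initialPath p q) (pathWeights p q a) s(i, l) ≤ 4 * Real.exp (-(2 * a)) := by
  have h1 := one_sub_correlation_bond_le (a := a) hij (by omega : (j : ℕ) < q)
  have h2 := one_sub_correlation_bond_le (a := a) hjl hl
  set G := initialPath p q
  set θ := pathWeights p q a
  have h : correlation G θ s(i, j) + correlation G θ s(j, l) - 1 ≤ correlation G θ s(i, l) := by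
    rw [← sum_isingProb G θ]
    unfold correlation
    rw [← Finset.sum_add_distrib, ← Finset.sum_sub_distrib]
    refine Finset.sum_le_sum fun x _ => ?_
    have hmul : pairSpin x s(i, l) = pairSpin x s(i, j) * pairSpin x s(j, l) := by
      simp only [pairSpin_mk]
      linear_combination -((x i : ℤ) : ℝ) * ((x l : ℤ) : ℝ) * spin_mul_self (x j)
    have hP := isingProb_pos G θ x
    rw [hmul]
    rcases pairSpin_eq_or x s(i, j) with h | h <;>
      rcases pairSpin_eq_or x s(j, l) with h' | h' <;> rw [h, h'] <;> linarith
  linarith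

/-- `1 - μ² ≤ 2 (1 - μ) ≤ 8 exp (-2a)`; `ha` guarantees `μ ≥ 0`. -/
lemma sq_moment_chord_le {p q n : ℕ} {a lam ℓ : ℝ} (hlam : 0 < lam) {i j l : Fin p}
    (hij : (i : ℕ) + 1 = j) (hjl : (j : ℕ) + 1 = l) (hl : (l : ℕ) < q)
    (ha : 4 * Real.exp (-(2 * a)) ≤ 1)
    (hn : n * (8 * Real.tanh lam ^ 2 * Real.exp (-(2 * a))) ≤ ℓ) :
    (∑ y, isingProb (initialPath p q) (pathWeights p q a) y *
      edgeRatio lam (initialPath p q) (pathWeights p q a) s(i, l) y ^ 2) ^ n ≤ Real.exp ℓ := by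
  have hμ := one_sub_correlation_chord_le (a := a) hij hjl hl
  have h1 := sum_isingProb_mul_edgeRatio_sq_le hlam (initialPath p q) (pathWeights p q a)
    s(i, l) (by linarith)
  set μ := correlation (initialPath p q) (pathWeights p q a) s(i, l)
  have h2 : 1 - μ ^ 2 ≤ 8 * Real.exp (-(2 * a)) := by nlinarith [sq_nonneg (1 - μ)]
  have h3 := mul_le_mul_of_nonneg_left h2 (sq_nonneg (Real.tanh lam))
  have h4 := Real.add_one_le_exp (8 * Real.tanh lam ^ 2 * Real.exp (-(2 * a)))
  refine (pow_le_pow_left₀ (Finset.sum_nonneg fun y _ =>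
    mul_nonneg (isingProb_pos _ _ y).le (sq_nonneg _))
    (show _ ≤ Real.exp (8 * Real.tanh lam ^ 2 * Real.exp (-(2 * a))) by linarith) n).trans ?_
  rw [← Real.exp_nat_mul, Real.exp_le_exp]
  exact hn

/-- If the second sample size bound exceeds the first, then `ω` is large compared to `lam`. -/
lemma sixteen_mul_exp_lt {p k : ℕ} {lam ω : ℝ} (hp : 3 ≤ p) (hk : 8 < k)
    (hkp : k ≤ p.choose 2) (hlam : 0 < lam) (hlamω : lam ≤ ω)
    (h : Real.log p / (2 * lam * Real.tanh lam) <
      Real.exp (ω / 2) * Real.log ((k : ℝ) / 8) /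
        (64 * ω * Real.exp (5 * lam / 2) * Real.sinh lam)) :
    16 * Real.exp (5 * lam / 2) < Real.exp (ω / 2) := by
  have ht := tanh_pos hlam
  have hs := Real.sinh_pos_iff.2 hlam
  have hω : 0 < ω := hlam.trans_le hlamω
  have hp3 : (3 : ℝ) ≤ p := by exact_mod_cast hp
  have hk8 : (8 : ℝ) < k := by exact_mod_cast hk
  have hlogp : 0 < Real.log p := Real.log_pos (by linarith)
  have hkp' : (k : ℝ) ≤ p * (p - 1) / 2 := by
    rw [← Nat.cast_choose_two]
    exact_mod_cast hkp
  have hlog : Real.log ((k : ℝ) / 8) ≤ 2 * Real.log p := by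
    have : 2 * Real.log p = Real.log ((p : ℝ) ^ 2) := by rw [Real.log_pow]; norm_num
    rw [this]
    exact Real.log_le_log (by linarith) (by nlinarith)
  rw [div_lt_div_iff₀ (by positivity) (by positivity)] at h
  -- By `tanh ≤ sinh` and `lam ≤ ω`, both sides of `h` compare with multiples of `log p * ω * sinh
  -- lam`, and `16 = 64 / 4`.
  have h1 : Real.exp (ω / 2) * Real.log ((k : ℝ) / 8) * (2 * lam * Real.tanh lam) ≤
      Real.exp (ω / 2) * (2 * Real.log p) * (2 * ω * Real.sinh lam) := by
    have := tanh_le_sinh hlam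
    gcongr
  have h2 : (16 * Real.exp (5 * lam / 2)) * (4 * Real.log p * ω * Real.sinh lam) <
      Real.exp (ω / 2) * (4 * Real.log p * ω * Real.sinh lam) := by linarith
  exact lt_of_mul_lt_mul_right h2 (by positivity)

theorem informedError_of_lt_of_le {n p k : ℕ} {lam ω : ℝ} (hp : 3 ≤ p) (hkp : k ≤ p.choose 2)
    (hlam : 0 < lam) (hlamω : lam ≤ ω) (hω : 1 ≤ ω)
    (hn₁ : Real.log p / (2 * lam * Real.tanh lam) < n)
    (hn₂ : (n : ℝ) ≤ Real.exp (ω / 2) * Real.log ((k : ℝ) / 8) /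
        (64 * ω * Real.exp (5 * lam / 2) * Real.sinh lam)) (φ : InformedDecoder n p k) :
    InformedError lam ω φ := by
  classical
  have ht := tanh_pos hlam
  have hs := Real.sinh_pos_iff.2 hlam
  have hp3 : (3 : ℝ) ≤ p := by exact_mod_cast hp
  have hden : 0 < 64 * ω * Real.exp (5 * lam / 2) * Real.sinh lam := by positivity
  have hpos : 0 < Real.exp (ω / 2) * Real.log ((k : ℝ) / 8) /
      (64 * ω * Real.exp (5 * lam / 2) * Real.sinh lam) := by
    refine lt_of_le_of_lt ?_ (hn₁.trans_le hn₂)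
    have := Real.log_nonneg (by linarith : (1 : ℝ) ≤ p)
    positivity
  have hlogk : 0 < Real.log ((k : ℝ) / 8) :=
    pos_of_mul_pos_right ((div_pos_iff_of_pos_right hden).1 hpos) (Real.exp_pos _).le
  have hk : 8 < k := by
    by_contra! hk
    have hk' : (k : ℝ) ≤ 8 := by exact_mod_cast hk
    exact absurd (Real.log_nonpos (by positivity) (by linarith)) hlogk.not_ge
  have hexp := sixteen_mul_exp_lt hp hk hkp hlam hlamω (hn₁.trans_le hn₂)
  have h5 : 5 * lam < ω := by
    have : Real.exp (5 * lam / 2) < Real.exp (ω / 2) := by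
      linarith [Real.exp_pos (5 * lam / 2)]
    linarith [Real.exp_lt_exp.1 this]
  have hp5 : 5 ≤ p := by
    by_contra! hp5
    have : p.choose 2 ≤ Nat.choose 4 2 := Nat.choose_le_choose 2 (by omega)
    rw [show Nat.choose 4 2 = 6 from rfl] at this
    omega
  have hkp' : (k : ℝ) ≤ p * (p - 1) / 2 := by
    rw [← Nat.cast_choose_two]
    exact_mod_cast hkp
  -- `q = min p k`: the path has at most `k - 1` edges, leaving one for the chord.
  obtain ⟨q, hqp, hqk, hq5, hkq⟩ : ∃ q : ℕ, q ≤ p ∧ q ≤ k ∧ 5 ≤ q ∧ (k : ℝ) ≤ q * q / 2 := by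
    rcases le_total p k with h | h
    · exact ⟨p, le_rfl, h, hp5, by nlinarith⟩
    · have hk8 : (8 : ℝ) < k := by exact_mod_cast hk
      exact ⟨k, h, le_rfl, by omega, by nlinarith⟩
  obtain ⟨r, rfl⟩ : ∃ r, q = r + 2 := ⟨q - 2, by omega⟩
  -- The largest bond that leaves room for a chord at an inner vertex; `5 * lam < ω` makes it at
  -- least `lam`.
  set a := (ω - lam) / 2 with ha
  have ha2 : -(2 * a) = lam - ω := by rw [ha]; ring
  have hchord_le : 4 * Real.exp (-(2 * a)) ≤ 1 := by
    have h1 : 1 ≤ Real.exp (5 * lam / 2) := Real.one_le_exp (by positivity)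
    have h2 : Real.exp (-(2 * a)) * Real.exp (ω / 2) ≤ 1 := by
      rw [← Real.exp_add, ha2]
      exact Real.exp_le_one_iff.2 (by linarith)
    nlinarith [Real.exp_pos (-(2 * a))]
  have hnℓ : n * (8 * Real.tanh lam ^ 2 * Real.exp (-(2 * a))) ≤
      Real.log ((k : ℝ) / 8) * (1 / 2) := by
    rw [le_div_iff₀ hden] at hn₂
    -- `tanh² ≤ tanh ≤ sinh`, and `ω ≥ 1` enters here.
    have h1 : Real.tanh lam ^ 2 ≤ ω * Real.sinh lam := by
      nlinarith [tanh_le_sinh hlam, tanh_le_one (x := lam)]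
    have h2 : Real.exp (-(2 * a)) * Real.exp (ω / 2) ≤ Real.exp (5 * lam / 2) := by
      rw [← Real.exp_add, Real.exp_le_exp, ha2]
      linarith
    have h3 : n * (8 * Real.tanh lam ^ 2 * Real.exp (-(2 * a))) * Real.exp (5 * lam / 2) ≤
        Real.log ((k : ℝ) / 8) * (1 / 2) * Real.exp (5 * lam / 2) :=
      calc n * (8 * Real.tanh lam ^ 2 * Real.exp (-(2 * a))) * Real.exp (5 * lam / 2)
          ≤ n * (8 * (ω * Real.sinh lam) * Real.exp (-(2 * a))) * Real.exp (5 * lam / 2) := by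
            gcongr
        _ = (n * (64 * ω * Real.exp (5 * lam / 2) * Real.sinh lam)) *
              Real.exp (-(2 * a)) * (1 / 8) := by ring
        _ ≤ (Real.exp (ω / 2) * Real.log ((k : ℝ) / 8)) * Real.exp (-(2 * a)) * (1 / 8) := by
            gcongr
        _ = Real.log ((k : ℝ) / 8) * (1 / 8) * (Real.exp (-(2 * a)) * Real.exp (ω / 2)) := by
            ring
        _ ≤ Real.log ((k : ℝ) / 8) * (1 / 2) * Real.exp (5 * lam / 2) := by
            gcongr
            norm_num
    exact le_of_mul_le_mul_right h3 (Real.exp_pos _)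
  let chord : Fin r → Sym2 (Fin p) := fun m => s(⟨m, by omega⟩, ⟨m + 2, by omega⟩)
  have hchord : Function.Injective chord := by
    intro m m' h
    simp only [chord, Sym2.eq_iff, Fin.mk.injEq] at h
    exact Fin.ext (by omega)
  have hcard : (Finset.univ.image chord).card = r := by
    rw [Finset.card_image_of_injective _ hchord, Finset.card_univ, Fintype.card_fin]
  refine (isBase_initialPath (a := a) hqp hqk (by omega) hlam (by linarith)
    (by linarith)).informedError_of_sq_le (by omega) hlam φ (Finset.univ.image chord) ?_
    (by omega) ?_
  · intro e he
    obtain ⟨m, -, rfl⟩ := Finset.mem_image.1 he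
    constructor
    · simp [chord]
    · rw [initialPath_adj]
      dsimp only
      omega
  · intro e he
    obtain ⟨m, -, rfl⟩ := Finset.mem_image.1 he
    have hm : (m : ℕ) + 2 < r + 2 := Nat.add_lt_add_right m.2 2
    refine (sq_moment_chord_le (p := p) hlam (q := r + 2) (i := ⟨m, by omega⟩)
      (j := ⟨m + 1, by omega⟩) (l := ⟨m + 2, by omega⟩) rfl rfl hm hchord_le hnℓ).trans ?_
    -- The goal is `√(k / 8) ≤ r / 2`; it follows from `k ≤ (r + 2)² / 2` because `r + 2 ≤ 2 r`.
    rw [hcard, ← Real.rpow_def_of_pos (by positivity), ← Real.sqrt_eq_rpow,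
      Real.sqrt_le_left (by positivity)]
    have hr : (3 : ℝ) ≤ r := by exact_mod_cast (by omega : 3 ≤ r)
    push_cast at hkq
    nlinarith

end IsingSelection

theorem theorem2 (n p k : ℕ) (lam ω : ℝ)
    (hp : 3 ≤ p) (hk : 1 ≤ k) (hkp : k ≤ p.choose 2)
    (hlam : 0 < lam) (hlamω : lam ≤ ω) (hω : 1 ≤ ω)
    (hn : (n : ℝ) ≤ max (Real.log p / (2 * lam * Real.tanh lam))
      (Real.exp (ω / 2) * Real.log ((k : ℝ) / 8) /
        (64 * ω * Real.exp (5 * lam / 2) * Real.sinh lam))) :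
    (∀ φ : IsingSelection.Decoder n p k,
      ∃ (G : SimpleGraph (Fin p)) (θ : IsingSelection.Weights p),
        IsingSelection.IsModel p k lam ω G θ ∧
        1 / 2 ≤ IsingSelection.errorProb φ G θ) ∧
    (∀ φ : IsingSelection.InformedDecoder n p k,
      ∃ Θ : SimpleGraph (Fin p) → IsingSelection.Weights p,
        IsingSelection.IsWeightAssignment p k lam ω Θ ∧
        ∃ G : SimpleGraph (Fin p), IsingSelection.IsModel p k lam ω G (Θ G) ∧
          1 / 2 ≤ IsingSelection.errorProb (φ Θ) G (Θ G)) := by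
  have hinformed : ∀ φ : IsingSelection.InformedDecoder n p k,
      IsingSelection.InformedError lam ω φ := by
    intro φ
    by_cases h : (n : ℝ) ≤ Real.log p / (2 * lam * Real.tanh lam)
    · exact IsingSelection.informedError_of_le_log_div hp hk hlam hlamω h φ
    · exact IsingSelection.informedError_of_lt_of_le hp hkp hlam hlamω hω (not_le.1 h)
        ((le_max_iff.1 hn).resolve_left h) φ
  refine ⟨fun φ => ?_, hinformed⟩
  -- An uninformed decoder is an informed one that ignores the assignment.
  obtain ⟨Θ, -, G, hG, herr⟩ := hinformed fun _ => φ
  exact ⟨G, Θ G, hG, herr⟩
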